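/- **Conventions.** Points $p,q\in\mathbb Z^2$ are $c_1$-adjacent if $|p_1-q_1|+|p_2-q_2|=1$, and $c_2$-adjacent if $p\ne q$ and $|p_1-q_1|\le 1$, $|p_2-q_2|\le 1$; they are *diagonal neighbours* if they are $c_2$- but not $c_1$-adjacent. For $X\subseteq\mathbb Z^2$, a map $f:X\to X$ is $c_1$-*continuous* if it maps $c_1$-connected subsets of $X$ to $c_1$-connected sets. A set $A\subseteq X$ is a *freezing set* for $(X,c_1)$ if the identity is the only $c_1$-continuous $f:X\to X$ with $f(a)=a$ for all $a\in A$; it is a *cold set* (1-cold set) for $(X,c_1)$ if every $c_1$-continuous $f:X\to X$ with $f(a)=a$ for all $a\in A$ satisfies $d_{c_1}(x,f(x))\le 1$ for all $x\in X$, where $d_{c_1}$ is the length of a shortest $c_1$-path in $X$. A *$c_2$-closed curve* is a finite cyclic sequence $S$ of distinct points of $\mathbb Z^2$ in which consecutive points are $c_2$-adjacent. It is a *bounding curve* of $X$ if $\mathbb Z^2\setminus S$ has exactly two $c_1$-components, a finite one $\mathrm{Int}(S)$ and an infinite one, and $X=S\cup \mathrm{Int}(S)$; then $X$ is a *digital disk*.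 A *digital line segment* is a finite $c_1$- or $c_2$-connected set of at least two points that are collinear. The *sides* of $S$ are the maximal digital line segments formed by points that are consecutive along $S$; a segment is *axis-parallel* if it is horizontal or vertical, and *slanted* if its slope is $\pm1$. Where two sides of $S$ meet in exactly one point $p$, they form an *interior angle* of $S$ at $p$, measured on the side of $\mathrm{Int}(S)$. A digital disk $X$ is *thick* if, for some bounding curve $S$ of $X$: * for every slanted side $\sigma$ of $S$ and every $p\in\sigma$ that is not an endpoint of $\sigma$, some $c\in X\setminus\sigma$ is a diagonal neighbour of $p$; * for every vertex $p$ of an interior angle of $S$ of measure $\pi/2$ there is $q\in \mathrm{Int}(S)$ that is a diagonal neighbour of $p$ if both sides of the angle are axis-parallel, and is $c_1$-adjacent to $p$ if both are slanted; * for every vertex $p$ of an interior angle of $S$ of measure $3\pi/4$ there are $b,b'\in X$ strictly inside the angle such that $b$ is a diagonal neighbour of $p$ and $b'$ is $c_1$-adjacent to $p$. A finite set $Y\subset\mathbb Z^2$ is *digitally convex* if it is a single point, or a digital line segment, or a digital disk with a bounding curve $S$ such that the endpoints of the sides of $S$ are exactly the vertices of the convex hull of $Y$ in $\mathbb R^2$.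 **Theorem.** Let $X\subset\mathbb Z^2$ be a thick, digitally convex digital disk, and let $A\subseteq X$. Then $A$ is a cold set for $(X,c_1)$ if and only if $A$ is a freezing set for $(X,c_1)$. -/

import Mathlib

namespace DigitalImage

/-- The digital plane `ℤ²`. -/
abbrev Plane : Type := ℤ × ℤ

/-- `c₁`-adjacency (4-adjacency) in `ℤ²`. -/
def c1 : SimpleGraph Plane where
  Adj p q := |p.1 - q.1| + |p.2 - q.2| = 1
  symm := ⟨fun p q h => by rwa [abs_sub_comm q.1, abs_sub_comm q.2]⟩
  loopless := ⟨fun p h => by simp at h⟩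

/-- `c₂`-adjacency (8-adjacency) in `ℤ²`. -/
def c2 : SimpleGraph Plane where
  Adj p q := p ≠ q ∧ |p.1 - q.1| ≤ 1 ∧ |p.2 - q.2| ≤ 1
  symm := ⟨fun p q h => by
    rw [abs_sub_comm q.1, abs_sub_comm q.2]
    exact ⟨h.1.symm, h.2⟩⟩
  loopless := ⟨fun p h => h.1 rfl⟩

/-! ### Continuity, freezing sets, cold sets

A digital image `(X, κ)` is a graph; below it is `κ.induce X` on the vertex type `X`. -/

section Maps

variable {V : Type*} (G : SimpleGraph V)

/-- Digital continuity of a self-map: connected subsets have connected images. -/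
def IsContinuous (f : V → V) : Prop :=
  ∀ Y : Set V, (G.induce Y).Preconnected → (G.induce (f '' Y)).Preconnected

/-- `A` is a freezing set. -/
def IsFreezing (A : Set V) : Prop :=
  ∀ f : V → V, IsContinuous G f → (∀ a ∈ A, f a = a) → f = id

/-- `A` is an `s`-cold set. The path-length metric is `SimpleGraph.edist`, which is `⊤` for points
that are not joined by a path. -/
def IsSCold (s : ℕ) (A : Set V) : Prop :=
  ∀ f : V → V, IsContinuous G f → (∀ a ∈ A, f a = a) → ∀ x, G.edist x (f x) ≤ s

/-- A cold set is a 1-cold set. -/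
def IsCold (A : Set V) : Prop := IsSCold G 1 A

end Maps

/-! ### Plane geometry -/

/-- The inclusion of `ℤ²` in the Euclidean plane, taken to be `ℂ`. -/
noncomputable def toC (p : Plane) : ℂ := ⟨(p.1 : ℝ), (p.2 : ℝ)⟩

/-- The counterclockwise angle, in `[0, 2π)`, from the direction of `u` to that of `v`
(for nonzero `u` and `v`). -/
noncomputable def ccwAngle (u v : Plane) : ℝ :=
  toIcoMod Real.two_pi_pos 0 (Complex.arg (toC v / toC u))

/-- A digital line segment: a finite `c₁`- or `c₂`-connected set of more than one point, all of
whose points are collinear. -/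
def IsSegment (Y : Set Plane) : Prop :=
  Y.Finite ∧ Y.Nontrivial ∧ ((c1.induce Y).Connected ∨ (c2.induce Y).Connected) ∧
    Collinear ℝ (toC '' Y)

/-- All slopes between points of `Y` are `±1`. -/
def IsSlanted (Y : Set Plane) : Prop :=
  ∀ p ∈ Y, ∀ q ∈ Y, |p.1 - q.1| = |p.2 - q.2|

/-- `Y` is contained in a horizontal or a vertical line. -/
def IsAxisParallel (Y : Set Plane) : Prop :=
  (∀ p ∈ Y, ∀ q ∈ Y, p.1 = q.1) ∨ (∀ p ∈ Y, ∀ q ∈ Y, p.2 = q.2)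

/-! ### Closed curves and disks -/

/-- A `c₂`-closed curve `s₀, s₁, …, s_m = s₀` with `s₀, …, s_{m-1}` distinct, indexed cyclically. -/
structure ClosedCurve where
  /-- the number `m` of points -/
  len : ℕ
  [len_ne_zero : NeZero len]
  /-- the points, in the order in which the curve visits them -/
  pt : ZMod len → Plane
  injective : Function.Injective pt
  step : ∀ i, pt i = pt (i + 1) ∨ c2.Adj (pt i) (pt (i + 1))

attribute [instance] ClosedCurve.len_ne_zero

namespace ClosedCurve

variable (S : ClosedCurve)

/-- The set of points of the curve. -/
def carrier : Set Plane := Set.range S.pt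

/-- The complement of the curve, with `c₁`-adjacency. -/
abbrev complGraph : SimpleGraph ↥(S.carrierᶜ) := c1.induce S.carrierᶜ

/-- `Int(S)`: the points off the curve that lie in a finite `c₁`-component of its complement. -/
def interior : Set Plane :=
  {p | ∃ h : p ∈ S.carrierᶜ, (S.complGraph.connectedComponentMk ⟨p, h⟩).supp.Finite}

/-- `S` is a bounding curve of `X`: the complement of `S` has exactly two `c₁`-components, one
finite and one infinite, and `X` is the union of `S` and the finite one. -/
def IsBoundingCurve (X : Set Plane) : Prop :=
  (∃ C D : S.complGraph.ConnectedComponent,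
    C.supp.Finite ∧ D.supp.Infinite ∧ ∀ E, E = C ∨ E = D) ∧
  X = S.carrier ∪ S.interior

/-- The points `s_i, s_{i+1}, …, s_{i+k}`, consecutive along the curve. -/
def arc (i : ZMod S.len) (k : ℕ) : Set Plane :=
  {p | ∃ j : ℕ, j ≤ k ∧ p = S.pt (i + j)}

/-- The arc from `s_i` to `s_{i+k}` is a side of `S`: it is a digital line segment, and is maximal
among the digital line segments formed by consecutive points of the curve. -/
def IsSide (i : ZMod S.len) (k : ℕ) : Prop :=
  IsSegment (S.arc i k) ∧
    ∀ (i' : ZMod S.len) (k' : ℕ),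
      IsSegment (S.arc i' k') → S.arc i k ⊆ S.arc i' k' → S.arc i' k' = S.arc i k

/-- The endpoints of the sides of `S`. -/
def sideEndpoints : Set Plane :=
  {p | ∃ i k, S.IsSide i k ∧ (p = S.pt i ∨ p = S.pt (i + k))}

/-- `S` runs counterclockwise around `Int(S)`: the total angle that it sweeps out as seen from a
point of `Int(S)` (which is `2π` times the winding number) is positive. -/
def IsCcw : Prop :=
  ∀ q ∈ S.interior, 0 < ∑ i, Complex.arg (toC (S.pt (i + 1) - q) / toC (S.pt i - q))

/-- The direction at `s_i` from which the interior angle there is swept counterclockwise: the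
interior lies to the left of a counterclockwise curve, and to the right of a clockwise one. -/
noncomputable def firstRay (i : ZMod S.len) : Plane :=
  open scoped Classical in
  if S.IsCcw then S.pt (i + 1) - S.pt i else S.pt (i - 1) - S.pt i

/-- The direction at `s_i` at which the interior angle there ends. -/
noncomputable def secondRay (i : ZMod S.len) : Plane :=
  open scoped Classical in
  if S.IsCcw then S.pt (i - 1) - S.pt i else S.pt (i + 1) - S.pt i

/-- The measure of the interior angle at `s_i`. -/
noncomputable def interiorAngle (i : ZMod S.len) : ℝ :=
  ccwAngle (S.firstRay i) (S.secondRay i)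

/-- `z` lies strictly inside the interior angle at `s_i`. -/
def InsideAngle (i : ZMod S.len) (z : Plane) : Prop :=
  0 < ccwAngle (S.firstRay i) (z - S.pt i) ∧
    ccwAngle (S.firstRay i) (z - S.pt i) < S.interiorAngle i

/-- `s_i` is the vertex of an interior angle, formed by the side `s_{i-k}, …, s_i` and the side
`s_i, …, s_{i+l}`. -/
def IsAngle (i : ZMod S.len) (k l : ℕ) : Prop :=
  S.IsSide (i - k) k ∧ S.IsSide i l ∧ S.arc (i - k) k ∩ S.arc i l = {S.pt i}

end ClosedCurve

/-- Diagonal neighbours: `c₂`-adjacent but not `c₁`-adjacent. -/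
def DiagAdj (p q : Plane) : Prop := c2.Adj p q ∧ ¬ c1.Adj p q

/-- `X` is slant-thick at the point `p` of the slanted side `σ`. The diagonal neighbour `c` lies
across the side and not along it: a point `p` of `σ` that is not an endpoint always has two diagonal
neighbours in `σ` itself. -/
def IsSlantThickAt (X σ : Set Plane) (p : Plane) : Prop :=
  ∃ c ∈ X, c ∉ σ ∧ DiagAdj c p

/-- `X`, with bounding curve `S`, is 90°-thick at the vertex `s_i` of the interior angle formed by
the sides `s_{i-k}, …, s_i` and `s_i, …, s_{i+l}`. -/
def Is90ThickAt (S : ClosedCurve) (i : ZMod S.len) (k l : ℕ) : Prop :=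
  ∃ q ∈ S.interior,
    (IsAxisParallel (S.arc (i - k) k) ∧ IsAxisParallel (S.arc i l) → DiagAdj q (S.pt i)) ∧
    (IsSlanted (S.arc (i - k) k) ∧ IsSlanted (S.arc i l) → c1.Adj q (S.pt i))

/-- `X`, with bounding curve `S`, is 135°-thick at the vertex `s_i` of an interior angle. -/
def Is135ThickAt (X : Set Plane) (S : ClosedCurve) (i : ZMod S.len) : Prop :=
  ∃ b ∈ X, ∃ b' ∈ X, S.InsideAngle i b ∧ S.InsideAngle i b' ∧
    DiagAdj b (S.pt i) ∧ c1.Adj b' (S.pt i)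

/-- `X` is a thick digital disk, with the thickness tested on some bounding curve. -/
def IsThickDisk (X : Set Plane) : Prop :=
  ∃ S : ClosedCurve, S.IsBoundingCurve X ∧
    (∀ (i : ZMod S.len) (k : ℕ), S.IsSide i k → IsSlanted (S.arc i k) →
      ∀ p ∈ S.arc i k, p ≠ S.pt i → p ≠ S.pt (i + k) → IsSlantThickAt X (S.arc i k) p) ∧
    (∀ (i : ZMod S.len) (k l : ℕ), S.IsAngle i k l → S.interiorAngle i = Real.pi / 2 →
      Is90ThickAt S i k l) ∧
    (∀ (i : ZMod S.len) (k l : ℕ), S.IsAngle i k l → S.interiorAngle i = 3 * Real.pi / 4 →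
      Is135ThickAt X S i)

/-- Digital convexity: a single point, or a digital line segment, or a digital disk with a bounding
curve whose sides have as their endpoints the vertices of the convex hull. -/
def IsDigitallyConvex (Y : Set Plane) : Prop :=
  (∃ p, Y = {p}) ∨ IsSegment Y ∨
    ∃ S : ClosedCurve, S.IsBoundingCurve Y ∧
      toC '' S.sideEndpoints = (convexHull ℝ (toC '' Y)).extremePoints ℝ

end DigitalImage

/-!
Call a vertex foldable if its neighbours are all neighbours of one other vertex. Folding it onto
that vertex moves it by more than `1`, so a cold set contains all foldable points. A bounding curve
of a digitally convex disk turns only at extreme points of the convex hull, and there the disk is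
so pointed that the turning point is foldable or carries a foldable leaf. Let `f` be continuous and
fix the points of a cold set. Then `f` fixes the turning points. It also fixes the rest of the
curve: the straight stretches between turning points are geodesics, and stepping off one by a unit
increases the distance to one of its ends. Finally, if `f x = x + e` with `e ≠ 0`, then the points
that `f` translates by `e` are interior, and this finite set is invariant under `q ↦ q - e`, which
is absurd.
-/

namespace DigitalImage

/-! ### Continuous maps of graphs -/

section Graph

variable {V W : Type*} {G : SimpleGraph V} {H : SimpleGraph W} {f : V → V}

lemma isContinuous_iff :
    IsContinuous G f ↔ ∀ x y, G.Adj x y → f x = f y ∨ G.Adj (f x) (f y) := by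
  refine ⟨fun hf x y hxy => ?_, fun h Y hY => ?_⟩
  · by_contra! hne
    have himage := hf _ (SimpleGraph.induce_pair_connected_of_adj hxy).preconnected
    rw [Set.image_pair] at himage
    have : Nontrivial ({f x, f y} : Set V) := (Set.nontrivial_pair hne.1).coe_sort
    obtain ⟨⟨z, hz⟩, hadj⟩ := himage.exists_adj_of_nontrivial ⟨f x, by simp⟩
    rcases hz with rfl | rfl
    · exact G.irrefl hadj
    · exact hne.2 hadj
  · have hstep (x y : Y) (hxy : (G.induce Y).Adj x y) : (G.induce (f '' Y)).Reachable
        ⟨f x, Set.mem_image_of_mem f x.2⟩ ⟨f y, Set.mem_image_of_mem f y.2⟩ := by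
      rcases h x y hxy with heq | hadj
      · simp only [heq, SimpleGraph.Reachable.refl]
      · exact SimpleGraph.Adj.reachable hadj
    rintro ⟨_, x, hx, rfl⟩ ⟨_, y, hy, rfl⟩
    have hxy := hY ⟨x, hx⟩ ⟨y, hy⟩
    simp only [SimpleGraph.reachable_iff_reflTransGen] at hstep hxy ⊢
    exact hxy.lift' (fun z : Y => (⟨f z, Set.mem_image_of_mem f z.2⟩ : f '' Y)) hstep

lemma IsContinuous.edist_map_le (hf : IsContinuous G f) (x y : V) :
    G.edist (f x) (f y) ≤ G.edist x y := by
  refine le_iInf fun p => ?_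
  induction p with
  | nil => simp
  | @cons u v w huv p ih =>
    have hstep : G.edist (f u) (f v) ≤ 1 := by
      rw [SimpleGraph.edist_le_one_iff_adj_or_eq]
      exact (isContinuous_iff.1 hf u v huv).symm
    calc G.edist (f u) (f w) ≤ G.edist (f u) (f v) + G.edist (f v) (f w) := G.edist_triangle
      _ ≤ 1 + p.length := add_le_add hstep ih
      _ = (SimpleGraph.Walk.cons huv p).length := by
        rw [SimpleGraph.Walk.length_cons, Nat.cast_add, Nat.cast_one, add_comm]

variable (G) in
/-- The vertex `v` is dominated by another vertex, so that it can be folded onto that vertex by a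
continuous map that fixes all the other vertices. -/
def IsFoldable (v : V) : Prop := ∃ q, q ≠ v ∧ ∀ w, G.Adj v w → G.Adj q w

variable (G) in
/-- A foldable vertex is attached to the graph by a single edge, at `v`. -/
def HasFoldableLeaf (v : V) : Prop := ∃ w, IsFoldable G w ∧ ∀ u, G.Adj w u ↔ u = v

lemma IsFoldable.of_iso (φ : G ≃g H) {v : V} (h : IsFoldable H (φ v)) : IsFoldable G v := by
  obtain ⟨q, hne, hadj⟩ := h
  refine ⟨φ.symm q, fun heq => hne (by rw [← heq, φ.apply_symm_apply]), fun w hw => ?_⟩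
  rw [← φ.map_adj_iff, φ.apply_symm_apply]
  exact hadj _ (φ.map_adj_iff.2 hw)

lemma HasFoldableLeaf.of_iso (φ : G ≃g H) {v : V} (h : HasFoldableLeaf H (φ v)) :
    HasFoldableLeaf G v := by
  obtain ⟨w, hw, hadj⟩ := h
  rw [← φ.apply_symm_apply w] at hw
  refine ⟨φ.symm w, hw.of_iso φ, fun u => ?_⟩
  rw [← φ.map_adj_iff, φ.apply_symm_apply, hadj, φ.injective.eq_iff]

/-- The fold of `v` onto a dominating vertex `q` moves `v` by more than `1`, because `q` is not
adjacent to `v`. -/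
lemma IsCold.mem_of_isFoldable {A : Set V} (hA : IsCold G A) {v : V} (hv : IsFoldable G v) :
    v ∈ A := by
  classical
  obtain ⟨q, hne, hadj⟩ := hv
  by_contra hvA
  have hfold : IsContinuous G (Function.update id v q) := by
    refine isContinuous_iff.2 fun x y hxy => Or.inr ?_
    rcases eq_or_ne x v with rfl | hx
    · rw [Function.update_self, Function.update_of_ne hxy.ne']
      exact hadj y hxy
    rw [Function.update_of_ne hx]
    rcases eq_or_ne y v with rfl | hy
    · rw [Function.update_self]
      exact (hadj x hxy.symm).symm
    · rwa [Function.update_of_ne hy]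
  have hdist := hA _ hfold
    (fun a ha => Function.update_of_ne (ne_of_mem_of_not_mem ha hvA) q id) v
  rw [Function.update_self, Nat.cast_one, SimpleGraph.edist_le_one_iff_adj_or_eq] at hdist
  exact hdist.elim (fun h => G.irrefl (hadj q h)) hne.symm

lemma IsFreezing.isSCold {A : Set V} (hA : IsFreezing G A) (s : ℕ) : IsSCold G s A := by
  intro f hf hfix x
  simp [hA f hf hfix]

/-- The path from a leaf `w` to `l` passes through the neighbour `v` of `w`; as `f` fixes both ends
and cannot increase distances, `f v` is a neighbour of `w`. -/
lemma IsContinuous.fixed_of_leaf (hf : IsContinuous G f) {v w l : V}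
    (hleaf : ∀ u, G.Adj w u ↔ u = v) (hw : f w = w) (hl : f l = l) (hwl : l ≠ w)
    (hreach : G.Reachable v l) : f v = v := by
  have hadj : G.Adj w v := (hleaf v).2 rfl
  rcases isContinuous_iff.1 hf w v hadj with heq | hadj'
  · obtain ⟨p, hp⟩ := (hadj.reachable.trans hreach).exists_walk_length_eq_edist
    cases p with
    | nil => exact absurd rfl hwl
    | @cons _ u _ hu p =>
      obtain rfl := (hleaf u).1 hu
      have hle := (hf.edist_map_le u l).trans (SimpleGraph.edist_le p)
      rw [← heq, hw, hl, ← hp, SimpleGraph.Walk.length_cons] at hle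
      exact absurd (Nat.cast_le.1 hle) (by omega)
  · rwa [hw, hleaf] at hadj'

end Graph

/-! ### The digital plane -/

section Plane

lemma c1_adj_iff {p q : Plane} :
    c1.Adj p q ↔ (p.1 - q.1).natAbs + (p.2 - q.2).natAbs = 1 := by
  change |p.1 - q.1| + |p.2 - q.2| = 1 ↔ _
  simp only [Int.abs_eq_natAbs]
  omega

lemma c2_adj_iff {p q : Plane} : c2.Adj p q ↔
    (p.1 ≠ q.1 ∨ p.2 ≠ q.2) ∧ (p.1 ≤ q.1 + 1 ∧ q.1 ≤ p.1 + 1) ∧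
      p.2 ≤ q.2 + 1 ∧ q.2 ≤ p.2 + 1 := by
  change (p ≠ q ∧ |p.1 - q.1| ≤ 1 ∧ |p.2 - q.2| ≤ 1) ↔ _
  rw [Ne, Prod.ext_iff, Int.abs_eq_natAbs, Int.abs_eq_natAbs]
  omega

/-- The `ℓ¹` distance, which is the path metric of `c₁` on the whole digital plane. -/
def dist1 (p q : Plane) : ℕ := (p.1 - q.1).natAbs + (p.2 - q.2).natAbs

lemma dist1_le_edist {X : Set Plane} (x y : X) :
    (dist1 x y : ℕ∞) ≤ (c1.induce X).edist x y := by
  refine le_iInf fun p => Nat.cast_le.2 ?_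
  induction p with
  | nil => simp [dist1]
  | cons hadj p ih =>
    rw [SimpleGraph.comap_adj, c1_adj_iff] at hadj
    simp only [dist1, Function.Embedding.subtype_apply, SimpleGraph.Walk.length_cons] at *
    omega

/-- A unit step away from an inner point of a line segment increases the `ℓ¹` distance to one of
the two ends. -/
lemma eq_of_dist1_le {p q d : Plane} (h : q = p ∨ c1.Adj p q) {k l : ℕ}
    (hfwd : dist1 q (p + k • d) ≤ dist1 p (p + k • d))
    (hbwd : dist1 q (p - l • d) ≤ dist1 p (p - l • d)) : q = p := by
  refine h.resolve_right fun hadj => ?_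
  have hsign (x : ℤ) : (0 ≤ k * x ∧ 0 ≤ l * x) ∨ (k * x ≤ 0 ∧ l * x ≤ 0) := by
    rcases le_total 0 x with hx | hx
    · exact Or.inl ⟨by positivity, by positivity⟩
    · exact Or.inr ⟨mul_nonpos_of_nonneg_of_nonpos (by positivity) hx,
        mul_nonpos_of_nonneg_of_nonpos (by positivity) hx⟩
  have h1 := hsign d.1
  have h2 := hsign d.2
  rw [c1_adj_iff] at hadj
  simp only [dist1, Prod.fst_add, Prod.snd_add, Prod.fst_sub, Prod.snd_sub, nsmul_eq_mul,
    Prod.fst_mul, Prod.snd_mul, Prod.fst_natCast, Prod.snd_natCast] at hfwd hbwd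
  omega

/-- The determinant of two vectors. -/
def cross (u v : Plane) : ℤ := u.1 * v.2 - u.2 * v.1

lemma cross_self (u : Plane) : cross u u = 0 := by
  rw [cross, mul_comm, sub_self]

lemma cross_zsmul_right (u v : Plane) (k : ℤ) : cross u (k • v) = k * cross u v := by
  simp only [cross, Prod.smul_fst, Prod.smul_snd, smul_eq_mul]
  ring

/-- The eight steps of `c₂`-adjacency. -/
def directions : Finset Plane :=
  {(1, 0), (1, 1), (0, 1), (-1, 1), (-1, 0), (-1, -1), (0, -1), (1, -1)}

lemma sub_mem_directions {p q : Plane} : q - p ∈ directions ↔ c2.Adj p q := by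
  simp only [c2_adj_iff, directions, Finset.mem_insert, Finset.mem_singleton, Prod.ext_iff,
    Prod.fst_sub, Prod.snd_sub]
  omega

lemma cross_ne_zero_of_mem_directions :
    ∀ d ∈ directions, ∀ d' ∈ directions, d' ≠ d → d' ≠ -d → cross d d' ≠ 0 := by
  decide

lemma exists_add_notMem {M : Type*} [AddCommGroup M] [IsAddTorsionFree M] {Y : Set M}
    (hY : Y.Finite) (hne : Y.Nonempty) {e : M} (he : e ≠ 0) : ∃ q ∈ Y, q + e ∉ Y := by
  by_contra! h
  obtain ⟨p, hp⟩ := hne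
  have hray (m : ℕ) : p + m • e ∈ Y := by
    induction m with
    | zero => simpa using hp
    | succ m ih => rw [succ_nsmul, ← add_assoc]; exact h _ ih
  refine Set.infinite_of_injective_forall_mem ?_ hray hY
  exact (add_right_injective p).comp (injective_nsmul_iff_not_isOfFinAddOrder.2
    (not_isOfFinAddOrder_of_isAddTorsionFree he))

end Plane

/-! ### Circuits and their turning points -/

section Circuit

variable {n : ℕ} {t : ZMod n → Plane} {i : ZMod n}

/-- The cyclic sequence `t` changes direction at `t i`. -/
def Turn (t : ZMod n → Plane) (i : ZMod n) : Prop := t (i + 1) - t i ≠ t i - t (i - 1)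

lemma turn_comp_neg : Turn (fun k => t (-k)) i ↔ Turn t (-i) := by
  rw [Turn, Turn, neg_add', neg_sub', sub_neg_eq_add, ← neg_sub (t (-i)) (t (-i - 1)),
    ← neg_sub (t (-i + 1)) (t (-i)), ne_eq, ne_eq, neg_inj, eq_comm]

lemma eq_add_nsmul_of_not_turn {m : ℕ} (h : ∀ j : ℕ, 0 < j → j < m → ¬ Turn t (i + j)) :
    ∀ j ≤ m, t (i + j) = t i + j • (t (i + 1) - t i) := by
  have hstep (j : ℕ) (hj : j < m) : t (i + j + 1) - t (i + j) = t (i + 1) - t i := by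
    induction j with
    | zero => simp
    | succ j ih =>
      have hturn := not_not.1 (h (j + 1) (by omega) hj)
      rw [show i + (j + 1 : ℕ) - 1 = i + j by push_cast; ring] at hturn
      rw [hturn, ← ih (by omega), Nat.cast_succ, add_assoc]
  intro j hj
  induction j with
  | zero => simp
  | succ j ih =>
    rw [Nat.cast_succ, ← add_assoc, ← sub_add_cancel (t (i + j + 1)) (t (i + j)),
      hstep j (by omega), ih (by omega), succ_nsmul]
    abel

lemma exists_turn_of_injective (hn : 2 ≤ n) (ht : Function.Injective t) (i : ZMod n) :
    ∃ m : ℕ, 0 < m ∧ Turn t (i + m) ∧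
      ∀ j ≤ m, t (i + j) = t i + j • (t (i + 1) - t i) := by
  classical
  have hex : ∃ m : ℕ, 0 < m ∧ Turn t (i + m) := by
    by_contra! h
    have hclosed := eq_add_nsmul_of_not_turn (fun j hj (_ : j < n) => h j hj) n le_rfl
    rw [ZMod.natCast_self, add_zero, left_eq_add, smul_eq_zero, sub_eq_zero] at hclosed
    have : Fact (1 < n) := ⟨hn⟩
    rcases hclosed with h0 | h1
    · omega
    · simpa using ht h1
  refine ⟨Nat.find hex, (Nat.find_spec hex).1, (Nat.find_spec hex).2,
    eq_add_nsmul_of_not_turn fun j hj hlt hturn => Nat.find_min hex hlt ⟨hj, hturn⟩⟩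

/-- The cyclic sequence `t` is a `c₂`-closed curve that is not degenerate to three points or
fewer. -/
structure IsCircuit (t : ZMod n → Plane) : Prop where
  four_le : 4 ≤ n
  injective : Function.Injective t
  adj : ∀ i, c2.Adj (t i) (t (i + 1))

namespace IsCircuit

lemma neZero (h : IsCircuit t) : NeZero n := ⟨by have := h.four_le; omega⟩

lemma pt_ne (h : IsCircuit t) {j : ZMod n} {m : ℕ} (h0 : 0 < m) (hm : m < 4) (hj : j = i + m) :
    t j ≠ t i := by
  refine h.injective.ne ?_
  rw [hj, Ne, add_eq_left, ZMod.natCast_eq_zero_iff]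
  exact fun hdvd => absurd (Nat.le_of_dvd h0 hdvd) (by have := h.four_le; omega)

lemma reverse (h : IsCircuit t) : IsCircuit fun k => t (-k) where
  four_le := h.four_le
  injective := h.injective.comp neg_injective
  adj i := by
    have := (h.adj (-i - 1)).symm
    rwa [sub_add_cancel, ← neg_add'] at this

lemma adj_sub_one (h : IsCircuit t) (i : ZMod n) : c2.Adj (t (i - 1)) (t i) := by
  simpa using h.adj (i - 1)

lemma exists_turn (h : IsCircuit t) (i : ZMod n) : ∃ m : ℕ, 0 < m ∧ Turn t (i + m) ∧
    ∀ j ≤ m, t (i + j) = t i + j • (t (i + 1) - t i) :=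
  exists_turn_of_injective (by have := h.four_le; omega) h.injective i

lemma exists_turn_sub (h : IsCircuit t) (i : ZMod n) : ∃ m : ℕ, 0 < m ∧ Turn t (i - m) ∧
    ∀ j ≤ m, t (i - j) = t i - j • (t i - t (i - 1)) := by
  obtain ⟨m, hm, hturn, hline⟩ := h.reverse.exists_turn (-i)
  rw [turn_comp_neg, neg_add', neg_neg] at hturn
  refine ⟨m, hm, hturn, fun j hj => ?_⟩
  have := hline j hj
  rwa [neg_add', neg_neg, neg_add', neg_neg, ← neg_sub (t i), smul_neg, ← sub_eq_add_neg] at this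

lemma cross_ne_zero_of_turn (h : IsCircuit t) (hi : Turn t i) :
    cross (t i - t (i - 1)) (t (i + 1) - t i) ≠ 0 := by
  refine cross_ne_zero_of_mem_directions _ (sub_mem_directions.2 (h.adj_sub_one i)) _
    (sub_mem_directions.2 (h.adj i)) hi ?_
  rw [neg_sub, Ne, sub_left_inj]
  exact h.pt_ne (m := 2) two_pos (by norm_num) (by push_cast; ring)

/-- The next turning points in the two directions are distinct, since the two rays that lead to
them are. -/
lemma exists_turn_ne_ne (h : IsCircuit t) (hi : Turn t i) (k : ZMod n) :
    ∃ j, Turn t j ∧ j ≠ i ∧ j ≠ k := by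
  obtain ⟨m, hm, hturn, hline⟩ := h.exists_turn i
  obtain ⟨m', hm', hturn', hline'⟩ := h.exists_turn_sub i
  have hpt : t (i + m) - t i = (m : ℤ) • (t (i + 1) - t i) := by
    rw [hline m le_rfl, natCast_zsmul]
    abel
  have hpt' : t (i - m') - t i = (-m' : ℤ) • (t i - t (i - 1)) := by
    rw [hline' m' le_rfl, neg_smul, natCast_zsmul]
    abel
  have hcross := h.cross_ne_zero_of_turn hi
  have hoff : cross (t i - t (i - 1)) (t (i + m) - t i) ≠ 0 := by
    rw [hpt, cross_zsmul_right]
    exact mul_ne_zero (by omega) hcross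
  have hon : cross (t i - t (i - 1)) (t (i - m') - t i) = 0 := by
    rw [hpt', cross_zsmul_right, cross_self, mul_zero]
  have hne : i + m ≠ i := fun heq => hoff (by simp [heq, cross])
  have hne' : i - m' ≠ i := by
    intro heq
    rw [heq, sub_self, eq_comm, smul_eq_zero] at hpt'
    exact hpt'.elim (by omega) fun h0 => hcross (by simp [h0, cross])
  rcases eq_or_ne (i + m) k with rfl | hk
  · exact ⟨i - m', hturn', hne', fun heq => hoff (heq ▸ hon)⟩
  · exact ⟨i + m, hturn, hne, hk⟩

end IsCircuit

end Circuit

/-! ### Crossing numbers -/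

section Crossing

/-- The signed crossing of the step from `p` to `p'` with the vertical half-line that starts just
to the right of `q` and goes up. -/
def crossing (q p p' : Plane) : ℤ :=
  (if p.1 = q.1 ∧ p'.1 = q.1 + 1 ∧ q.2 < p.2 then 1 else 0) -
    (if p'.1 = q.1 ∧ p.1 = q.1 + 1 ∧ q.2 < p'.2 then 1 else 0)

variable {n : ℕ} [NeZero n] {t : ZMod n → Plane} {i : ZMod n} {p q : Plane}

/-- The crossing number of a closed curve about the point `q`, a substitute for the winding
number. -/
def crossingNumber (t : ZMod n → Plane) (q : Plane) : ℤ :=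
  ∑ i, crossing q (t i) (t (i + 1))

lemma sum_add_one {M : Type*} [AddCommMonoid M] (h : ZMod n → M) :
    ∑ i, h (i + 1) = ∑ i, h i :=
  Equiv.sum_comp (Equiv.addRight (1 : ZMod n)) h

lemma coord_ne_of_notMem_range {ι : Type*} {t : ι → Plane} (h : q ∉ Set.range t) (i : ι) :
    (t i).1 ≠ q.1 ∨ (t i).2 ≠ q.2 := by
  by_contra! heq
  exact h ⟨i, Prod.ext heq.1 heq.2⟩

lemma crossingNumber_up (hq : (p.1, p.2 + 1) ∉ Set.range t) :
    crossingNumber t p = crossingNumber t (p.1, p.2 + 1) := by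
  refine Finset.sum_congr rfl fun i _ => ?_
  have := coord_ne_of_notMem_range hq i
  have := coord_ne_of_notMem_range hq (i + 1)
  simp only [crossing]
  split_ifs <;> omega

lemma crossingNumber_right (hadj : ∀ i, c2.Adj (t i) (t (i + 1))) (hp : p ∉ Set.range t)
    (hq : (p.1 + 1, p.2) ∉ Set.range t) :
    crossingNumber t p = crossingNumber t (p.1 + 1, p.2) := by
  have hterm (k : ZMod n) :
      crossing p (t k) (t (k + 1)) - crossing (p.1 + 1, p.2) (t k) (t (k + 1)) =
      (if (t (k + 1)).1 = p.1 + 1 ∧ p.2 < (t (k + 1)).2 then 1 else 0) -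
        (if (t k).1 = p.1 + 1 ∧ p.2 < (t k).2 then 1 else 0) := by
    have := coord_ne_of_notMem_range hp k
    have := coord_ne_of_notMem_range hp (k + 1)
    have := coord_ne_of_notMem_range hq k
    have := coord_ne_of_notMem_range hq (k + 1)
    have := c2_adj_iff.1 (hadj k)
    simp only [crossing]
    split_ifs <;> omega
  rw [← sub_eq_zero, crossingNumber, crossingNumber, ← Finset.sum_sub_distrib]
  simp only [hterm]
  rw [Finset.sum_sub_distrib, sub_eq_zero]
  exact sum_add_one fun k => if (t k).1 = p.1 + 1 ∧ p.2 < (t k).2 then (1 : ℤ) else 0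

lemma crossingNumber_eq_of_adj (hadj : ∀ i, c2.Adj (t i) (t (i + 1))) (hp : p ∉ Set.range t)
    (hq : q ∉ Set.range t) (hpq : c1.Adj p q) : crossingNumber t p = crossingNumber t q := by
  have hcases : q = (p.1 + 1, p.2) ∨ p = (q.1 + 1, q.2) ∨
      q = (p.1, p.2 + 1) ∨ p = (q.1, q.2 + 1) := by
    rw [c1_adj_iff] at hpq
    simp only [Prod.ext_iff]
    omega
  rcases hcases with h | h | h | h
  · rw [crossingNumber_right hadj hp (h ▸ hq), ← h]
  · rw [crossingNumber_right hadj hq (h ▸ hp), ← h]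
  · rw [crossingNumber_up (p := p) (h ▸ hq), ← h]
  · rw [crossingNumber_up (p := q) (h ▸ hp), ← h]

lemma crossingNumber_eq_of_preconnected (hadj : ∀ i, c2.Adj (t i) (t (i + 1))) {Y : Set Plane}
    (hY : (c1.induce Y).Preconnected) (hdisj : ∀ i, t i ∉ Y) (hp : p ∈ Y) (hq : q ∈ Y) :
    crossingNumber t p = crossingNumber t q := by
  have hoff {y : Plane} (hy : y ∈ Y) : y ∉ Set.range t := by
    rintro ⟨i, rfl⟩
    exact hdisj i hy
  obtain ⟨w⟩ := hY ⟨p, hp⟩ ⟨q, hq⟩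
  have hwalk {x y : Y} (w : (c1.induce Y).Walk x y) :
      crossingNumber t x = crossingNumber t y := by
    induction w with
    | nil => rfl
    | @cons x y _ hxy _ ih =>
      exact (crossingNumber_eq_of_adj hadj (hoff x.2) (hoff y.2) hxy).trans ih
  exact hwalk w

lemma sum_leaving (ht : Function.Injective t) (h : t i = p) (P : Plane → Prop)
    [DecidablePred P] : ∑ k, (if t k = p ∧ P (t (k + 1)) then (1 : ℤ) else 0) =
      if P (t (i + 1)) then 1 else 0 := by
  simp only [← h, ht.eq_iff, ite_and, Finset.sum_ite_eq', Finset.mem_univ, if_true]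

lemma sum_entering (ht : Function.Injective t) (h : t (i + 1) = p) (P : Plane → Prop)
    [DecidablePred P] : ∑ k, (if t (k + 1) = p ∧ P (t k) then (1 : ℤ) else 0) =
      if P (t i) then 1 else 0 := by
  simp only [← h, ht.eq_iff, add_left_inj, ite_and, Finset.sum_ite_eq', Finset.mem_univ, if_true]

/-- The crossing numbers differ by the number of steps from `(0, 0)` to `(1, 1)` minus the number of
reverse steps. -/
lemma crossingNumber_ne_of_diagonal_step (h : IsCircuit t) (h0 : t i = (0, 0))
    (h1 : t (i + 1) = (1, 1)) (hp : (0, 1) ∉ Set.range t) (hq : (1, 0) ∉ Set.range t) :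
    crossingNumber t (0, 1) ≠ crossingNumber t (1, 0) := by
  have hback : t (i + 1 + 1) ≠ (0, 0) := by
    rw [← h0]
    exact h.pt_ne (m := 2) two_pos (by norm_num) (by push_cast; ring)
  have hterm (k : ZMod n) : crossing (0, 1) (t k) (t (k + 1)) - crossing (1, 0) (t k) (t (k + 1)) =
      ((if (t (k + 1)).1 = 1 ∧ 0 < (t (k + 1)).2 then 1 else 0) -
        (if (t k).1 = 1 ∧ 0 < (t k).2 then 1 else 0)) -
      ((if t k = (0, 0) ∧ t (k + 1) = (1, 1) then (1 : ℤ) else 0) -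
      (if t k = (1, 1) ∧ t (k + 1) = (0, 0) then (1 : ℤ) else 0)) := by
    have := coord_ne_of_notMem_range hp k
    have := coord_ne_of_notMem_range hp (k + 1)
    have := coord_ne_of_notMem_range hq k
    have := coord_ne_of_notMem_range hq (k + 1)
    have := c2_adj_iff.1 (h.adj k)
    simp only [crossing, Prod.ext_iff]
    split_ifs <;> omega
  rw [← sub_ne_zero, crossingNumber, crossingNumber, ← Finset.sum_sub_distrib]
  simp only [hterm]
  rw [Finset.sum_sub_distrib, Finset.sum_sub_distrib, Finset.sum_sub_distrib,
    sum_add_one fun k => if (t k).1 = 1 ∧ 0 < (t k).2 then (1 : ℤ) else 0, sub_self,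
    sum_leaving h.injective h0 (· = (1, 1)), sum_leaving h.injective h1 (· = (0, 0)),
    if_pos h1, if_neg hback]
  norm_num

/-- The crossing numbers differ by the number of steps from `(1, 0)` to the line `x = 2` minus the
number of reverse steps. -/
lemma fst_ne_two_of_crossingNumber_eq (h : IsCircuit t) (h0 : t i = (0, 0))
    (h1 : t (i + 1) = (1, 0)) (hq : (1, 1) ∉ Set.range t)
    (heq : crossingNumber t (1, -1) = crossingNumber t (1, 1)) : (t (i + 2)).1 ≠ 2 := by
  have hterm (k : ZMod n) :
      crossing (1, -1) (t k) (t (k + 1)) - crossing (1, 1) (t k) (t (k + 1)) =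
      (if t k = (1, 0) ∧ (t (k + 1)).1 = 2 then (1 : ℤ) else 0) -
      (if t (k + 1) = (1, 0) ∧ (t k).1 = 2 then (1 : ℤ) else 0) := by
    have := coord_ne_of_notMem_range hq k
    have := coord_ne_of_notMem_range hq (k + 1)
    simp only [crossing, Prod.ext_iff] at *
    split_ifs <;> omega
  rw [← sub_eq_zero, crossingNumber, crossingNumber, ← Finset.sum_sub_distrib] at heq
  simp only [hterm] at heq
  rw [Finset.sum_sub_distrib, sum_leaving h.injective h1 (·.1 = 2),
    sum_entering h.injective h1 (·.1 = 2), h0, add_assoc, one_add_one_eq_two] at heq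
  intro h2
  simp [h2] at heq

end Crossing

/-! ### Disks whose curves turn at extreme points -/

section ConvexDisk

/-- The point `v` is not strictly between two points of `X`: a version of extremality in the convex
hull of `X` that avoids real coordinates. -/
def IsExtremeIn (X : Set Plane) (v : Plane) : Prop :=
  ∀ p ∈ X, ∀ q ∈ X, ∀ k l : ℤ, 0 < k → 0 < l → k • (p - v) + l • (q - v) = 0 → p = v

/-- The set `X` is bounded by the circuit `t`, which turns only at extreme points of `X`. -/
structure IsConvexDisk {n : ℕ} (t : ZMod n → Plane) (X : Set Plane) : Prop extends
    IsCircuit t where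
  mem : ∀ i, t i ∈ X
  finite : X.Finite
  mem_of_adj : ∀ p ∈ X, p ∉ Set.range t → ∀ q, c1.Adj p q → q ∈ X
  preconnected_compl : (c1.induce Xᶜ).Preconnected
  extreme : ∀ i, Turn t i → IsExtremeIn X (t i)

variable {n : ℕ} {t : ZMod n → Plane} {X : Set Plane} {i : ZMod n}

namespace IsConvexDisk

lemma notMem_range (D : IsConvexDisk t X) {p : Plane} (hp : p ∉ X) : p ∉ Set.range t := by
  rintro ⟨i, rfl⟩
  exact hp (D.mem i)

lemma crossingNumber_eq [NeZero n] (D : IsConvexDisk t X) {p q : Plane} (hp : p ∉ X)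
    (hq : q ∉ X) : crossingNumber t p = crossingNumber t q :=
  crossingNumber_eq_of_preconnected D.adj D.preconnected_compl (fun i h => h (D.mem i)) hp hq

lemma reverse (D : IsConvexDisk t X) : IsConvexDisk (fun k => t (-k)) X where
  toIsCircuit := D.toIsCircuit.reverse
  mem i := D.mem (-i)
  finite := D.finite
  mem_of_adj p hp h := D.mem_of_adj p hp (by
    rintro ⟨i, rfl⟩
    exact h ⟨-i, by simp only [neg_neg]⟩)
  preconnected_compl := D.preconnected_compl
  extreme i hi := D.extreme (-i) (turn_comp_neg.1 hi)

/-- The point `t i` as a vertex of the graph on `X`. -/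
def vertex (D : IsConvexDisk t X) (i : ZMod n) : X := ⟨t i, D.mem i⟩

/-- Otherwise, going down from a point of `X` below the axis, one would never leave `X`. -/
lemma snd_nonneg (D : IsConvexDisk t X) (h : ∀ k, 0 ≤ (t k).2) {p : Plane} (hp : p ∈ X) :
    0 ≤ p.2 := by
  by_contra! hneg
  obtain ⟨q, ⟨hqX, hq0⟩, hq⟩ := exists_add_notMem (Y := {q ∈ X | q.2 < 0})
    (D.finite.subset (Set.sep_subset _ _)) ⟨p, hp, hneg⟩ (e := (0, -1)) (by decide)
  refine hq ⟨D.mem_of_adj q hqX ?_ _ ?_, by simp only [Prod.snd_add]; omega⟩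
  · rintro ⟨k, rfl⟩
    exact absurd (h k) (not_le.2 hq0)
  · simp only [c1_adj_iff, Prod.fst_add, Prod.snd_add]
    omega

end IsConvexDisk

/-! ### Symmetries of the digital plane -/

/-- An affine automorphism of the digital plane that preserves both adjacencies. -/
structure IsSymmetry (e : Plane ≃ᵃ[ℤ] Plane) : Prop where
  c1_adj : ∀ {p q}, c1.Adj (e p) (e q) ↔ c1.Adj p q
  c2_adj : ∀ {p q}, c2.Adj (e p) (e q) ↔ c2.Adj p q

variable {e : Plane ≃ᵃ[ℤ] Plane}

/-- The restriction of a symmetry to an isomorphism of the graphs on `X` and on its image. -/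
def IsSymmetry.iso (he : IsSymmetry e) (X : Set Plane) : c1.induce X ≃g c1.induce (e '' X) :=
  SimpleGraph.Iso.induce ⟨e.toEquiv, he.c1_adj⟩ (e.injective.injOn.bijOn_image)

lemma map_sub_map (e : Plane ≃ᵃ[ℤ] Plane) (p q : Plane) : e p - e q = e.linear (p - q) :=
  (e.toAffineMap.linearMap_vsub p q).symm

lemma turn_map : Turn (e ∘ t) i ↔ Turn t i := by
  simp only [Turn, Function.comp_apply, map_sub_map, ne_eq, e.linear.injective.eq_iff]

lemma IsExtremeIn.map {v : Plane} (h : IsExtremeIn X v) (e : Plane ≃ᵃ[ℤ] Plane) :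
    IsExtremeIn (e '' X) (e v) := by
  rintro _ ⟨p, hp, rfl⟩ _ ⟨q, hq, rfl⟩ k l hk hl hzero
  rw [map_sub_map, map_sub_map, ← map_smul, ← map_smul, ← map_add,
    LinearEquiv.map_eq_zero_iff] at hzero
  rw [h p hp q hq k l hk hl hzero]

lemma IsConvexDisk.map (D : IsConvexDisk t X) (he : IsSymmetry e) :
    IsConvexDisk (e ∘ t) (e '' X) where
  four_le := D.four_le
  injective := e.injective.comp D.injective
  adj i := he.c2_adj.2 (D.adj i)
  mem i := Set.mem_image_of_mem e (D.mem i)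
  finite := D.finite.image e
  mem_of_adj := by
    rintro _ ⟨p, hp, rfl⟩ hrange q hq
    rw [← e.apply_symm_apply q, he.c1_adj] at hq
    rw [Set.range_comp, e.injective.mem_set_image] at hrange
    exact ⟨_, D.mem_of_adj p hp hrange _ hq, e.apply_symm_apply q⟩
  preconnected_compl := by
    rw [← Set.image_compl_eq e.bijective]
    exact (he.iso Xᶜ).preconnected_iff.1 D.preconnected_compl
  extreme i hi := (D.extreme i (turn_map.1 hi)).map e

/-- The pair `a`, `b` is a positively or negatively oriented orthonormal basis of the plane. -/
def IsFrame (a b : Plane) : Prop :=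
  ((a = (1, 0) ∨ a = (-1, 0)) ∧ (b = (0, 1) ∨ b = (0, -1))) ∨
    ((a = (0, 1) ∨ a = (0, -1)) ∧ (b = (1, 0) ∨ b = (-1, 0)))

instance (a b : Plane) : Decidable (IsFrame a b) := by unfold IsFrame; infer_instance

/-- The linear coordinates with respect to a frame. -/
@[simps apply]
def IsFrame.coords {a b : Plane} (h : IsFrame a b) : Plane ≃ₗ[ℤ] Plane where
  toFun p := (a.1 * p.1 + a.2 * p.2, b.1 * p.1 + b.2 * p.2)
  invFun p := (p.1 * a.1 + p.2 * b.1, p.1 * a.2 + p.2 * b.2)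
  left_inv p := by
    rcases h with ⟨rfl | rfl, rfl | rfl⟩ | ⟨rfl | rfl, rfl | rfl⟩ <;> simp
  right_inv p := by
    rcases h with ⟨rfl | rfl, rfl | rfl⟩ | ⟨rfl | rfl, rfl | rfl⟩ <;> simp
  map_add' p q := by ext <;> simp only [Prod.fst_add, Prod.snd_add] <;> ring
  map_smul' k p := by
    ext <;> simp only [Prod.smul_fst, Prod.smul_snd, smul_eq_mul, RingHom.id_apply] <;> ring

lemma exists_symmetry {a b : Plane} (h : IsFrame a b) (v : Plane) :
    ∃ e : Plane ≃ᵃ[ℤ] Plane, IsSymmetry e ∧ ∀ x y : ℤ, e (v + x • a + y • b) = (x, y) := by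
  refine ⟨(AffineEquiv.vaddConst ℤ v).symm.trans h.coords.toAffineEquiv, ⟨?_, ?_⟩, ?_⟩
  · intro p q
    simp only [c1_adj_iff, AffineEquiv.trans_apply, AffineEquiv.vaddConst_symm_apply, vsub_eq_sub,
      LinearEquiv.coe_toAffineEquiv, IsFrame.coords_apply, Prod.fst_sub, Prod.snd_sub]
    rcases h with ⟨rfl | rfl, rfl | rfl⟩ | ⟨rfl | rfl, rfl | rfl⟩ <;> simp only <;> omega
  · intro p q
    simp only [c2_adj_iff, AffineEquiv.trans_apply, AffineEquiv.vaddConst_symm_apply, vsub_eq_sub,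
      LinearEquiv.coe_toAffineEquiv, IsFrame.coords_apply, Prod.fst_sub, Prod.snd_sub]
    rcases h with ⟨rfl | rfl, rfl | rfl⟩ | ⟨rfl | rfl, rfl | rfl⟩ <;> simp only <;> omega
  · intro x y
    rw [AffineEquiv.trans_apply, AffineEquiv.vaddConst_symm_apply, vsub_eq_sub,
      LinearEquiv.coe_toAffineEquiv, IsFrame.coords_apply, add_assoc, add_sub_cancel_left]
    rcases h with ⟨rfl | rfl, rfl | rfl⟩ | ⟨rfl | rfl, rfl | rfl⟩ <;> simp

/-- At a turning point, `d` leads to the next point of the curve and `d'` to the previous one. -/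
lemma exists_isFrame : ∀ d ∈ directions, ∀ d' ∈ directions, d' ≠ d → d' ≠ -d →
    ∃ a ∈ directions, ∃ b ∈ directions, IsFrame a b ∧
      ((∃ x ∈ ({-1, 0, 1} : Finset ℤ), d = a ∧ d' = x • a + b ∨ d' = a ∧ d = x • a + b) ∨
        d = a + b ∧ d' = -a + b) := by
  decide

end ConvexDisk

/-! ### Turning points are foldable, or carry a foldable leaf -/

section Turn

lemma forall_pos_or_forall_neg {u : ℕ → ℤ} (hfwd : ∀ m, u (m + 1) ≤ u m + 1)
    (hbwd : ∀ m, u m ≤ u (m + 1) + 1) {a b : ℕ} (h : ∀ m, a ≤ m → m < b → u m ≠ 0) :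
    (∀ m, a ≤ m → m < b → 0 < u m) ∨ ∀ m, a ≤ m → m < b → u m < 0 := by
  have hsign (m : ℕ) (ha : a ≤ m) : m < b → (0 < u m ↔ 0 < u a) := by
    induction m, ha using Nat.le_induction with
    | base => exact fun _ => Iff.rfl
    | succ m ha ih =>
      intro hb
      have := ih (by omega)
      have := h m ha (by omega)
      have := h (m + 1) (by omega) hb
      have := hfwd m
      have := hbwd m
      omega
  by_cases hpos : 0 < u a
  · exact Or.inl fun m ha hb => (hsign m ha hb).2 hpos
  · refine Or.inr fun m ha hb => ?_
    have := hsign m ha hb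
    have := h m ha hb
    omega

namespace IsConvexDisk

variable {n : ℕ} {t : ZMod n → Plane} {X : Set Plane} {i : ZMod n}

lemma isFoldable_vertex_iff (D : IsConvexDisk t X) : IsFoldable (c1.induce X) (D.vertex i) ↔
    ∃ q ∈ X, q ≠ t i ∧ ∀ w ∈ X, c1.Adj (t i) w → c1.Adj q w :=
  ⟨fun ⟨q, hq, h⟩ => ⟨q, q.2, fun heq => hq (Subtype.ext heq), fun w hw => h ⟨w, hw⟩⟩,
    fun ⟨q, hqX, hq, h⟩ => ⟨⟨q, hqX⟩, fun heq => hq (congrArg Subtype.val heq), fun w => h w w.2⟩⟩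

/-- Otherwise, the curve would separate the other two corners of the unit square of a diagonal step,
but the complement of the disk is connected. -/
lemma exists_common_adj (D : IsConvexDisk t X) (hadj : ¬ c1.Adj (t i) (t (i + 1))) :
    ∃ m ∈ X, c1.Adj (t i) m ∧ c1.Adj m (t (i + 1)) := by
  have := D.neZero
  have hstep := D.adj i
  rw [c1_adj_iff] at hadj
  rw [c2_adj_iff] at hstep
  have hframe : IsFrame ((t (i + 1)).1 - (t i).1, 0) (0, (t (i + 1)).2 - (t i).2) := by
    left
    simp only [Prod.mk.injEq, and_true, true_and]
    omega
  obtain ⟨e, he, heq⟩ := exists_symmetry hframe (t i)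
  have h0 : e (t i) = (0, 0) := by simpa using heq 0 0
  have h1 : e (t (i + 1)) = (1, 1) := by
    rw [← heq 1 1]
    congr 1
    ext <;> simp
  have hmid : ∃ m ∈ X, e m = (0, 1) ∨ e m = (1, 0) := by
    by_contra! hnone
    have hD := D.map he
    have hp : (0, 1) ∉ e '' X := fun ⟨m, hm, hem⟩ => (hnone m hm).1 hem
    have hq : (1, 0) ∉ e '' X := fun ⟨m, hm, hem⟩ => (hnone m hm).2 hem
    exact crossingNumber_ne_of_diagonal_step hD.toIsCircuit h0 h1 (hD.notMem_range hp)
      (hD.notMem_range hq) (hD.crossingNumber_eq hp hq)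
  obtain ⟨m, hm, hem⟩ := hmid
  refine ⟨m, hm, ?_⟩
  rw [← he.c1_adj, ← he.c1_adj (p := m), h0, h1]
  rcases hem with hem | hem <;> rw [hem] <;> simp [c1_adj_iff]

lemma neg_notMem_of_turn (D : IsConvexDisk t X) (hi : Turn t i) (h0 : t i = 0) {p : Plane}
    (hp : p ∈ X) (hne : p ≠ 0) : -p ∉ X := fun h => by
  refine hne (h0 ▸ D.extreme i hi p hp (-p) h 1 1 one_pos one_pos ?_)
  rw [h0, one_smul, one_smul, sub_zero, sub_zero, add_neg_cancel]

/-- The side that starts at `t i` contains all the points of the curve on its line, because its ends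
are extreme. -/
lemma exists_side (D : IsConvexDisk t X) (hi : Turn t i) (h0 : t i = (0, 0))
    (h1 : t (i + 1) = (1, 0)) : ∃ K : ℕ, (∀ j : ℕ, j ≤ K → (t (i + j)).2 = 0) ∧
      ∀ k, (t k).2 = 0 → ∃ j : ℕ, j ≤ K ∧ k = i + j := by
  obtain ⟨K, hK, hturn, hline⟩ := D.exists_turn i
  have hside (j : ℕ) (hj : j ≤ K) : t (i + j) = ((j : ℤ), 0) := by
    rw [hline j hj, h0, h1]
    simp
  refine ⟨K, fun j hj => by rw [hside j hj], fun k hk => ?_⟩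
  obtain ⟨x, hx⟩ : ∃ x, t k = (x, 0) := ⟨_, Prod.ext rfl hk⟩
  have hx0 : 0 ≤ x := by
    by_contra! hneg
    have := D.extreme i hi _ (D.mem (i + 1)) _ (D.mem k) (-x) 1 (by omega) one_pos
      (by rw [h0, h1, hx]; simp)
    simp [h0, h1] at this
  have hxK : x ≤ K := by
    by_contra! hgt
    have := D.extreme (i + K) hturn _ (D.mem i) _ (D.mem k) (x - K) K (by omega) (by omega)
      (by rw [hside K le_rfl, h0, hx]; ext <;> simp; ring)
    rw [hside K le_rfl, h0, Prod.mk.injEq] at this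
    omega
  refine ⟨x.toNat, by omega, D.injective ?_⟩
  rw [hside _ (by omega), hx, Int.toNat_of_nonneg hx0]

lemma snd_nonneg_or_nonpos (D : IsConvexDisk t X) (hi : Turn t i) (h0 : t i = (0, 0))
    (h1 : t (i + 1) = (1, 0)) : (∀ k, 0 ≤ (t k).2) ∨ ∀ k, (t k).2 ≤ 0 := by
  have := D.neZero
  obtain ⟨K, hside, haxis⟩ := D.exists_side hi h0 h1
  have hstep (m : ℕ) := c2_adj_iff.1 (D.adj (i + m))
  have hne (m : ℕ) (hm : K + 1 ≤ m) (hmn : m < n) : (t (i + m)).2 ≠ 0 := by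
    intro hzero
    obtain ⟨j, hj, heq⟩ := haxis _ hzero
    have hval := congrArg ZMod.val (add_left_cancel heq)
    rw [ZMod.val_cast_of_lt hmn, ZMod.val_cast_of_lt (by omega)] at hval
    omega
  have hcyc (k : ZMod n) : ∃ m < n, k = i + (m : ℕ) := ⟨(k - i).val, ZMod.val_lt _, by simp⟩
  have hsign := forall_pos_or_forall_neg (u := fun m : ℕ => (t (i + m)).2)
    (fun m => by rw [Nat.cast_succ, ← add_assoc]; exact (hstep m).2.2.2)
    (fun m => by rw [Nat.cast_succ, ← add_assoc]; exact (hstep m).2.2.1) hne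
  refine hsign.imp (fun hpos k => ?_) (fun hneg k => ?_) <;> obtain ⟨m, hm, rfl⟩ := hcyc k <;>
    rcases le_or_gt m K with hmK | hmK
  · rw [hside m hmK]
  · exact (hpos m hmK hm).le
  · rw [hside m hmK]
  · exact (hneg m hmK hm).le

lemma snd_nonneg_of_turn (D : IsConvexDisk t X) (hi : Turn t i) (h0 : t i = (0, 0))
    (h1 : t (i + 1) = (1, 0)) (h2 : (t (i - 1)).2 = 1) {p : Plane} (hp : p ∈ X) : 0 ≤ p.2 :=
  D.snd_nonneg ((D.snd_nonneg_or_nonpos hi h0 h1).resolve_right fun h => by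
    have := h (i - 1)
    omega) hp

/-- Since `(1, -1)` and `(1, 1)` are both outside, the curve cannot go on to the right after
`(1, 0)`. -/
lemma next_eq_of_corner_notMem (D : IsConvexDisk t X) (h0 : t i = (0, 0)) (h1 : t (i + 1) = (1, 0))
    (hX : ∀ p ∈ X, 0 ≤ p.2) (hc : (1, 1) ∉ X) : t (i + 2) = (0, 1) := by
  have := D.neZero
  have hbelow : ((1, -1) : Plane) ∉ X := fun h => absurd (hX _ h) (by norm_num)
  have hfst := fst_ne_two_of_crossingNumber_eq D.toIsCircuit h0 h1 (D.notMem_range hc)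
    (D.crossingNumber_eq hbelow hc)
  have hadj := c2_adj_iff.1 (D.adj (i + 1))
  rw [show i + 1 + 1 = i + 2 by ring, h1] at hadj
  have hne : t (i + 2) ≠ (0, 0) := h0 ▸ D.pt_ne (m := 2) two_pos (by norm_num) (by push_cast; rfl)
  have hne' : t (i + 2) ≠ (1, 1) := fun h => hc (h ▸ D.mem _)
  have hnonneg := hX _ (D.mem (i + 2))
  simp only [ne_eq, Prod.ext_iff] at *
  omega

/-- If `(1, 1)` belongs to `X`, then `t i` can be folded onto it; otherwise the curve passes from
`(1, 0)` to `(0, 1)`, and the leaf `(1, 0)` can be folded onto `(0, 1)`. -/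
lemma foldable_of_axis_step (D : IsConvexDisk t X) (hi : Turn t i) (h0 : t i = (0, 0))
    (h1 : t (i + 1) = (1, 0)) (h2 : (t (i - 1)).2 = 1) :
    IsFoldable (c1.induce X) (D.vertex i) ∨ HasFoldableLeaf (c1.induce X) (D.vertex i) := by
  have hX (p : Plane) (hp : p ∈ X) : 0 ≤ p.2 := D.snd_nonneg_of_turn hi h0 h1 h2 hp
  have hleft : ((-1, 0) : Plane) ∉ X :=
    D.neg_notMem_of_turn hi h0 (h1 ▸ D.mem (i + 1)) (by decide)
  by_cases hc : ((1, 1) : Plane) ∈ X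
  · left
    rw [D.isFoldable_vertex_iff]
    refine ⟨(1, 1), hc, by simp [h0], fun w hw hadj => ?_⟩
    have hnonneg := hX w hw
    have hne : w ≠ (-1, 0) := fun h => hleft (h ▸ hw)
    rw [h0, c1_adj_iff] at hadj
    rw [c1_adj_iff]
    simp only [ne_eq, Prod.ext_iff] at *
    omega
  · right
    have h3 := D.next_eq_of_corner_notMem h0 h1 hX hc
    have hturn : Turn t (i + 1) := by
      rw [Turn, show i + 1 + 1 = i + 2 by ring, add_sub_cancel_right, h0, h1, h3]
      decide
    have hright : ((2, 0) : Plane) ∉ X := fun h => by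
      have := D.extreme (i + 1) hturn _ (D.mem i) _ h 1 1 one_pos one_pos (by simp [h0, h1])
      simp [h0, h1] at this
    have hleaf (w : X) : (c1.induce X).Adj (D.vertex (i + 1)) w ↔ w = D.vertex i := by
      rw [SimpleGraph.comap_adj, c1_adj_iff, Subtype.ext_iff]
      have hnonneg := hX w w.2
      have hne : w.1 ≠ (2, 0) := fun h => hright (h ▸ w.2)
      have hne' : w.1 ≠ (1, 1) := fun h => hc (h ▸ w.2)
      simp only [Function.Embedding.subtype_apply, vertex, h0, h1, ne_eq, Prod.ext_iff] at *
      omega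
    refine ⟨D.vertex (i + 1), ⟨D.vertex (i + 2), ?_, fun w hw => ?_⟩, hleaf⟩
    · simp [vertex, h1, h3]
    · rw [(hleaf w).1 hw, SimpleGraph.comap_adj, c1_adj_iff]
      simp [vertex, h0, h3]

/-- The midpoints of the diagonal steps at `t i` are `(0, 1)` and at most one of `(1, 0)` and
`(-1, 0)`. -/
lemma isFoldable_of_diagonal_steps (D : IsConvexDisk t X) (hi : Turn t i) (h0 : t i = (0, 0))
    (h1 : t (i + 1) = (1, 1)) (h2 : t (i - 1) = (-1, 1)) :
    IsFoldable (c1.induce X) (D.vertex i) := by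
  have hright : ((1, 0) : Plane) ∈ X → ((-1, 0) : Plane) ∉ X := fun h =>
    D.neg_notMem_of_turn hi h0 h (by decide)
  have hup : ((0, 1) : Plane) ∈ X := by
    obtain ⟨m, hm, hadj, hadj'⟩ := D.exists_common_adj (i := i) (by simp [h0, h1, c1_adj_iff])
    obtain ⟨m', hm', hadj₁, hadj₁'⟩ := D.exists_common_adj (i := i - 1)
      (by simp [h0, h2, c1_adj_iff])
    have hm_eq : m = (0, 1) ∨ m = (1, 0) := by
      rw [c1_adj_iff] at hadj hadj'
      simp only [h0, h1, Prod.ext_iff] at *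
      omega
    have hm_eq' : m' = (0, 1) ∨ m' = (-1, 0) := by
      rw [sub_add_cancel] at hadj₁'
      rw [c1_adj_iff] at hadj₁ hadj₁'
      simp only [h0, h2, Prod.ext_iff] at *
      omega
    rcases hm_eq with rfl | rfl
    · exact hm
    rcases hm_eq' with rfl | rfl
    · exact hm'
    · exact absurd hm' (hright hm)
  have hdown : ((0, -1) : Plane) ∉ X := D.neg_notMem_of_turn hi h0 hup (by decide)
  have hfold {q : Plane} (hq : q ∈ X) (hq2 : q.2 = 1) (hq1 : q.1 = 1 ∨ q.1 = -1)
      (hne : (-q.1, 0) ∉ X) : IsFoldable (c1.induce X) (D.vertex i) := by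
    rw [D.isFoldable_vertex_iff]
    refine ⟨q, hq, fun h => ?_, fun w hw hadj => ?_⟩
    · simp [h, h0] at hq2
    · have hwdown : w ≠ (0, -1) := fun h => hdown (h ▸ hw)
      have hwside : w ≠ (-q.1, 0) := fun h => hne (h ▸ hw)
      rw [h0, c1_adj_iff] at hadj
      rw [c1_adj_iff]
      simp only [ne_eq, Prod.ext_iff] at *
      omega
  by_cases hr : ((1, 0) : Plane) ∈ X
  · exact hfold (h1 ▸ D.mem (i + 1)) rfl (Or.inl rfl) (hright hr)
  · exact hfold (h2 ▸ D.mem (i - 1)) rfl (Or.inr rfl) (by simpa using hr)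

lemma foldable_of_image (D : IsConvexDisk t X) {e : Plane ≃ᵃ[ℤ] Plane} (he : IsSymmetry e)
    (h : IsFoldable (c1.induce (e '' X)) ((D.map he).vertex i) ∨
      HasFoldableLeaf (c1.induce (e '' X)) ((D.map he).vertex i)) :
    IsFoldable (c1.induce X) (D.vertex i) ∨ HasFoldableLeaf (c1.induce X) (D.vertex i) :=
  h.imp (.of_iso (he.iso X)) (.of_iso (he.iso X))

lemma foldable_of_unit_step (D : IsConvexDisk t X) (hi : Turn t i) {a b : Plane}
    (hframe : IsFrame a b) (h1 : t (i + 1) - t i = a) {x : ℤ} (h2 : t (i - 1) - t i = x • a + b) :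
    IsFoldable (c1.induce X) (D.vertex i) ∨ HasFoldableLeaf (c1.induce X) (D.vertex i) := by
  obtain ⟨e, he, heq⟩ := exists_symmetry hframe (t i)
  refine D.foldable_of_image he ((D.map he).foldable_of_axis_step (turn_map.2 hi) ?_ ?_ ?_)
  · simpa using heq 0 0
  · simpa [← h1] using heq 1 0
  · have := heq x 1
    rw [one_smul, add_assoc, ← h2, add_sub_cancel] at this
    exact congrArg Prod.snd this

lemma foldable_of_turn (D : IsConvexDisk t X) (hi : Turn t i) :
    IsFoldable (c1.induce X) (D.vertex i) ∨ HasFoldableLeaf (c1.induce X) (D.vertex i) := by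
  have hne : t (i - 1) ≠ t (i + 1) :=
    (D.pt_ne (i := i - 1) (m := 2) two_pos (by norm_num) (by push_cast; ring)).symm
  obtain ⟨a, -, b, -, hframe, ⟨x, -, ⟨h1, h2⟩ | ⟨h1, h2⟩⟩ | ⟨h1, h2⟩⟩ :=
    exists_isFrame _ (sub_mem_directions.2 (D.adj i)) _
      (sub_mem_directions.2 (D.adj_sub_one i).symm) (by simpa using hne)
      (by rw [← neg_sub (t i), Ne, neg_inj]; exact hi.symm)
  · exact D.foldable_of_unit_step hi hframe h1 h2
  · have := D.reverse.foldable_of_unit_step (i := -i) (x := x) (turn_comp_neg.2 (by rwa [neg_neg]))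
      hframe (by rw [← h1, neg_add', neg_neg]) (by rw [← h2, neg_sub', neg_neg, sub_neg_eq_add])
    simpa only [vertex, neg_neg] using this
  · obtain ⟨e, he, heq⟩ := exists_symmetry hframe (t i)
    refine D.foldable_of_image he (Or.inl ((D.map he).isFoldable_of_diagonal_steps
      (turn_map.2 hi) ?_ ?_ ?_))
    · simpa using heq 0 0
    · simpa [add_assoc, ← h1] using heq 1 1
    · simpa [add_assoc, ← h2] using heq (-1) 1

end IsConvexDisk

end Turn

/-! ### Rigidity -/

section Rigidity

lemma dist1_add_nsmul (p d : Plane) (k : ℕ) : dist1 p (p + k • d) = k * dist1 0 d := by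
  rw [← natCast_zsmul]
  simp only [dist1, Prod.fst_add, Prod.snd_add, Prod.smul_fst, Prod.smul_snd, Prod.fst_zero,
    Prod.snd_zero, sub_add_cancel_left, zero_sub, Int.natAbs_neg, smul_eq_mul, Int.natAbs_mul,
    Int.natAbs_natCast, mul_add]

namespace IsConvexDisk

variable {n : ℕ} {t : ZMod n → Plane} {X : Set Plane} {i : ZMod n} {f : X → X}

lemma edist_vertex_add_one_le (D : IsConvexDisk t X) (i : ZMod n) :
    (c1.induce X).edist (D.vertex i) (D.vertex (i + 1)) ≤ dist1 (t i) (t (i + 1)) := by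
  have hedge {x y : X} (h : c1.Adj x y) : (c1.induce X).edist x y ≤ 1 :=
    SimpleGraph.edist_le_one_iff_adj_or_eq.2 (Or.inl h)
  have hstep := c2_adj_iff.1 (D.adj i)
  by_cases hadj : c1.Adj (t i) (t (i + 1))
  · rw [show dist1 (t i) (t (i + 1)) = 1 from c1_adj_iff.1 hadj]
    exact hedge hadj
  · obtain ⟨m, hm, h1, h2⟩ := D.exists_common_adj hadj
    have htwo : 2 ≤ dist1 (t i) (t (i + 1)) := by
      rw [c1_adj_iff] at hadj
      rw [dist1]
      omega
    calc (c1.induce X).edist (D.vertex i) (D.vertex (i + 1))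
        ≤ (c1.induce X).edist (D.vertex i) ⟨m, hm⟩ +
          (c1.induce X).edist ⟨m, hm⟩ (D.vertex (i + 1)) := SimpleGraph.edist_triangle
      _ ≤ 1 + 1 := add_le_add (hedge h1) (hedge h2)
      _ ≤ dist1 (t i) (t (i + 1)) := by rw [one_add_one_eq_two]; exact_mod_cast htwo

lemma reachable_vertex (D : IsConvexDisk t X) (i j : ZMod n) :
    (c1.induce X).Reachable (D.vertex i) (D.vertex j) := by
  have := D.neZero
  have hadd (m : ℕ) : (c1.induce X).Reachable (D.vertex i) (D.vertex (i + m)) := by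
    induction m with
    | zero => simp
    | succ m ih =>
      rw [Nat.cast_succ, ← add_assoc]
      exact ih.trans (SimpleGraph.reachable_of_edist_ne_top
        (ne_top_of_le_ne_top (ENat.natCast_ne_top _) (D.edist_vertex_add_one_le _)))
  simpa using hadd (j - i).val

lemma edist_le_of_straight (D : IsConvexDisk t X) {d : Plane} {K : ℕ}
    (hline : ∀ j ≤ K, t (i + j) = t i + j • d) :
    (c1.induce X).edist (D.vertex i) (D.vertex (i + K)) ≤ dist1 (t i) (t (i + K)) := by
  rw [hline K le_rfl, dist1_add_nsmul]
  induction K with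
  | zero => simp
  | succ K ih =>
    have hlast : dist1 (t (i + K)) (t (i + K + 1)) = dist1 0 d := by
      rw [hline K (by omega), add_assoc, ← Nat.cast_succ, hline (K + 1) le_rfl, succ_nsmul,
        ← add_assoc]
      simpa using dist1_add_nsmul (t i + K • d) d 1
    have hstep := D.edist_vertex_add_one_le (i + K)
    rw [hlast] at hstep
    rw [Nat.cast_succ, ← add_assoc, Nat.succ_mul, Nat.cast_add]
    exact SimpleGraph.edist_triangle.trans
      (add_le_add (ih fun j hj => hline j (by omega)) hstep)

lemma dist1_map_le (D : IsConvexDisk t X) (hf : IsContinuous (c1.induce X) f) {d : Plane} {K : ℕ}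
    (hline : ∀ j ≤ K, t (i + j) = t i + j • d) (hfix : f (D.vertex (i + K)) = D.vertex (i + K)) :
    dist1 (f (D.vertex i)) (t (i + K)) ≤ dist1 (t i) (t (i + K)) := by
  rw [← Nat.cast_le (α := ℕ∞)]
  calc (dist1 (f (D.vertex i)) (t (i + K)) : ℕ∞)
      ≤ (c1.induce X).edist (f (D.vertex i)) (D.vertex (i + K)) :=
        dist1_le_edist _ (D.vertex (i + K))
    _ = (c1.induce X).edist (f (D.vertex i)) (f (D.vertex (i + K))) := by rw [hfix]
    _ ≤ (c1.induce X).edist (D.vertex i) (D.vertex (i + K)) := hf.edist_map_le _ _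
    _ ≤ dist1 (t i) (t (i + K)) := D.edist_le_of_straight hline

lemma fixed_of_turn (D : IsConvexDisk t X) (hf : IsContinuous (c1.induce X) f)
    (hfold : ∀ x, IsFoldable (c1.induce X) x → f x = x) (hi : Turn t i) :
    f (D.vertex i) = D.vertex i := by
  rcases D.foldable_of_turn hi with h | ⟨w, hw, hleaf⟩
  · exact hfold _ h
  obtain ⟨j, hj, hji, hjw⟩ : ∃ j, Turn t j ∧ D.vertex j ≠ D.vertex i ∧ D.vertex j ≠ w := by
    have hinj : Function.Injective D.vertex := fun k l h => D.injective (congrArg Subtype.val h)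
    by_cases hrange : ∃ k, D.vertex k = w
    · obtain ⟨k, rfl⟩ := hrange
      obtain ⟨j, hj, hji, hjk⟩ := D.exists_turn_ne_ne hi k
      exact ⟨j, hj, hinj.ne hji, hinj.ne hjk⟩
    · obtain ⟨j, hj, hji, -⟩ := D.exists_turn_ne_ne hi i
      exact ⟨j, hj, hinj.ne hji, fun h => hrange ⟨j, h⟩⟩
  rcases D.foldable_of_turn hj with h | ⟨w', hw', hleaf'⟩
  · exact hf.fixed_of_leaf hleaf (hfold _ hw) (hfold _ h) hjw (D.reachable_vertex i j)
  · refine hf.fixed_of_leaf hleaf (hfold _ hw) (hfold _ hw') ?_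
      ((D.reachable_vertex i j).trans ((hleaf' _).2 rfl).reachable.symm)
    rintro rfl
    exact hji ((hleaf _).1 ((hleaf' _).2 rfl))

/-- The stretch of the curve between two turning points is a geodesic of the disk, so that `f` does
not increase the distances from `t i` to the turning points that enclose it. -/
lemma fixed_vertex (D : IsConvexDisk t X) (hf : IsContinuous (c1.induce X) f)
    (hmove : ∀ x, (c1.induce X).edist x (f x) ≤ 1)
    (hfold : ∀ x, IsFoldable (c1.induce X) x → f x = x) (i : ZMod n) :
    f (D.vertex i) = D.vertex i := by
  by_cases hi : Turn t i
  · exact D.fixed_of_turn hf hfold hi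
  obtain ⟨k, -, hturn, hline⟩ := D.exists_turn i
  obtain ⟨l, -, hturn', hline'⟩ := D.exists_turn_sub i
  rw [← not_not.1 hi] at hline'
  have hfwd := D.dist1_map_le hf hline (D.fixed_of_turn hf hfold hturn)
  have hbwd : dist1 (f (D.vertex i)) (t (i - l)) ≤ dist1 (t i) (t (i - l)) := by
    have hreverse := D.reverse.dist1_map_le hf (i := -i) (K := l) (d := -(t (i + 1) - t i))
      (fun j hj => by rw [neg_add', neg_neg, hline' j hj, smul_neg, sub_eq_add_neg])
      (by simpa only [vertex, neg_add', neg_neg] using D.fixed_of_turn hf hfold hturn')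
    simpa only [vertex, neg_add', neg_neg] using hreverse
  rw [hline k le_rfl] at hfwd
  rw [hline' l le_rfl] at hbwd
  refine Subtype.ext (eq_of_dist1_le ?_ hfwd hbwd)
  exact (SimpleGraph.edist_le_one_iff_adj_or_eq.1 (hmove (D.vertex i))).symm.imp
    (fun h => congrArg Subtype.val h.symm) id

/-- If `f` translates an interior point `q` by `e`, then `f` translates `q - e` by `e` as well. -/
lemma map_sub_eq_add (D : IsConvexDisk t X) (hf : IsContinuous (c1.induce X) f)
    (hmove : ∀ x, (c1.induce X).edist x (f x) ≤ 1) {q e : Plane} (hq : q ∈ X)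
    (hrange : q ∉ Set.range t) (he : e ≠ 0) (hfq : (f ⟨q, hq⟩).1 = q + e) :
    ∃ h : q + -e ∈ X, (f ⟨q + -e, h⟩).1 = q + -e + e := by
  have hunit : e.1.natAbs + e.2.natAbs = 1 := by
    have hadj := (SimpleGraph.edist_le_one_iff_adj_or_eq.1 (hmove ⟨q, hq⟩)).resolve_right fun h =>
      he (by simpa [← h] using hfq)
    rw [SimpleGraph.comap_adj, c1_adj_iff] at hadj
    simp only [Function.Embedding.subtype_apply, hfq, Prod.fst_add, Prod.snd_add] at hadj
    omega
  have hadj : c1.Adj q (q + -e) := by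
    rw [c1_adj_iff, Prod.fst_add, Prod.snd_add, Prod.fst_neg, Prod.snd_neg]
    omega
  have hmem : q + -e ∈ X := D.mem_of_adj q hq hrange _ hadj
  refine ⟨hmem, ?_⟩
  have hnear := SimpleGraph.edist_le_one_iff_adj_or_eq.1 (hmove ⟨q + -e, hmem⟩)
  have hnext := isContinuous_iff.1 hf ⟨q, hq⟩ ⟨q + -e, hmem⟩ hadj
  simp only [SimpleGraph.comap_adj, c1_adj_iff, Function.Embedding.subtype_apply, Subtype.ext_iff,
    hfq, Prod.ext_iff, Prod.fst_add, Prod.snd_add, Prod.fst_neg, Prod.snd_neg] at hnear hnext ⊢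
  omega

lemma eq_id (D : IsConvexDisk t X) (hf : IsContinuous (c1.induce X) f)
    (hmove : ∀ x, (c1.induce X).edist x (f x) ≤ 1)
    (hfold : ∀ x, IsFoldable (c1.induce X) x → f x = x) : f = id := by
  funext x
  by_contra hne
  set e : Plane := (f x).1 - x.1 with he
  have he0 : e ≠ 0 := fun h => hne (Subtype.ext (sub_eq_zero.1 h))
  obtain ⟨q, ⟨hq, hfq⟩, hout⟩ := exists_add_notMem
    (Y := {q | ∃ h : q ∈ X, (f ⟨q, h⟩).1 = q + e}) (D.finite.subset fun q hq => hq.1)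
    ⟨x.1, x.2, by simp [he]⟩ (neg_ne_zero.2 he0)
  refine hout (D.map_sub_eq_add hf hmove hq ?_ he0 hfq)
  rintro ⟨i, rfl⟩
  have hfix := D.fixed_vertex hf hmove hfold i
  exact he0 (by simpa [vertex, hfq] using congrArg Subtype.val hfix)

end IsConvexDisk

end Rigidity

/-! ### Bounding curves -/

section BoundingCurve

lemma toC_injective : Function.Injective toC := fun p q h => by
  simp only [toC, Complex.ext_iff, Int.cast_inj] at h
  exact Prod.ext h.1 h.2

lemma toC_add_nsmul (p d : Plane) (j : ℕ) : toC (p + j • d) = (j : ℝ) • toC d +ᵥ toC p := by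
  apply Complex.ext <;> simp [toC] <;> ring

lemma cross_eq_zero_of_collinear {Y : Set Plane} (h : Collinear ℝ (toC '' Y)) {p q r : Plane}
    (hp : p ∈ Y) (hq : q ∈ Y) (hr : r ∈ Y) : cross (q - p) (r - q) = 0 := by
  obtain ⟨v, hv⟩ := (collinear_iff_of_mem (Set.mem_image_of_mem toC hq)).1 h
  obtain ⟨a, ha⟩ := hv _ (Set.mem_image_of_mem toC hp)
  obtain ⟨b, hb⟩ := hv _ (Set.mem_image_of_mem toC hr)
  simp only [toC, Complex.ext_iff, vadd_eq_add, Complex.add_re, Complex.add_im, Complex.smul_re,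
    Complex.smul_im, smul_eq_mul] at ha hb
  have hreal : ((q.1 : ℝ) - p.1) * (r.2 - q.2) - (q.2 - p.2) * (r.1 - q.1) = 0 := by
    rw [ha.1, ha.2, hb.1, hb.2]
    ring
  exact_mod_cast hreal

lemma isExtremeIn_of_mem_extremePoints {X : Set Plane} {v : Plane}
    (hv : toC v ∈ (convexHull ℝ (toC '' X)).extremePoints ℝ) : IsExtremeIn X v := by
  intro p hp q hq k l hk hl hzero
  have : (0 : ℝ) < k := Int.cast_pos.2 hk
  have : (0 : ℝ) < l := Int.cast_pos.2 hl
  refine toC_injective ((mem_extremePoints.1 hv).2 _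
    (subset_convexHull ℝ _ (Set.mem_image_of_mem toC hp)) _
    (subset_convexHull ℝ _ (Set.mem_image_of_mem toC hq))
    ⟨k / (k + l), l / (k + l), by positivity, by positivity, by field_simp, ?_⟩).1
  simp only [Prod.ext_iff, Prod.fst_add, Prod.snd_add, Prod.smul_fst, Prod.smul_snd, Prod.fst_sub,
    Prod.snd_sub, Prod.fst_zero, Prod.snd_zero, smul_eq_mul] at hzero
  have hfst : (k : ℝ) * (p.1 - v.1) + l * (q.1 - v.1) = 0 := by exact_mod_cast hzero.1
  have hsnd : (k : ℝ) * (p.2 - v.2) + l * (q.2 - v.2) = 0 := by exact_mod_cast hzero.2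
  apply Complex.ext <;>
    simp only [toC, Complex.add_re, Complex.add_im, Complex.smul_re, Complex.smul_im,
      smul_eq_mul] <;>
    field_simp
  · linear_combination hfst
  · linear_combination hsnd

lemma eq_or_eq_add_one_of_lt_four {n : ℕ} (h0 : n ≠ 0) (h4 : n < 4) (i j : ZMod n) :
    j = i ∨ j = i + 1 ∨ i = j + 1 := by
  revert i j
  interval_cases n
  · exact absurd rfl h0
  all_goals decide

namespace ClosedCurve

variable {S : ClosedCurve} {X : Set Plane}

lemma IsBoundingCurve.mem_of_adj (h : S.IsBoundingCurve X) {p : Plane} (hp : p ∈ X)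
    (hpS : p ∉ S.carrier) {q : Plane} (hq : c1.Adj p q) : q ∈ X := by
  rw [h.2] at hp ⊢
  by_cases hqS : q ∈ S.carrier
  · exact Or.inl hqS
  obtain ⟨hpc, hfin⟩ := hp.resolve_left hpS
  have hcomp : S.complGraph.connectedComponentMk ⟨q, hqS⟩ =
      S.complGraph.connectedComponentMk ⟨p, hpc⟩ :=
    SimpleGraph.ConnectedComponent.eq.2
      (SimpleGraph.Adj.reachable (G := S.complGraph) (u := ⟨q, hqS⟩) (v := ⟨p, hpc⟩) hq.symm)
  exact Or.inr ⟨hqS, by rwa [hcomp]⟩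

lemma IsBoundingCurve.finite (h : S.IsBoundingCurve X) : X.Finite := by
  obtain ⟨⟨C, D, hC, hD, hCD⟩, rfl⟩ := h
  refine (Set.finite_range S.pt).union ((hC.image Subtype.val).subset ?_)
  rintro p ⟨hp, hfin⟩
  refine ⟨⟨p, hp⟩, (hCD _).resolve_right fun hpD => hD ?_, rfl⟩
  rwa [hpD] at hfin

lemma IsBoundingCurve.exists_notMem_carrier (h : S.IsBoundingCurve X) :
    ∃ p ∈ X, p ∉ S.carrier := by
  obtain ⟨⟨C, -, hC, -⟩, rfl⟩ := h
  obtain ⟨p, rfl⟩ := C.exists_rep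
  exact ⟨p, Or.inr ⟨p.2, hC⟩, p.2⟩

lemma IsBoundingCurve.preconnected_compl (h : S.IsBoundingCurve X) :
    (c1.induce Xᶜ).Preconnected := by
  have hout {p : Plane} (hp : p ∉ X) : p ∉ S.carrier := fun hpS => hp (h.2 ▸ Or.inl hpS)
  have hwalk {u v : ↥(S.carrierᶜ)} (w : S.complGraph.Walk u v) (hu : u.1 ∉ X) (hv : v.1 ∉ X) :
      (c1.induce Xᶜ).Reachable ⟨u, hu⟩ ⟨v, hv⟩ := by
    induction w with
    | nil => rfl
    | @cons u w v huw _ ih =>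
      have hw : w.1 ∉ X := fun hw => hu (h.mem_of_adj hw w.2 huw.symm)
      exact (SimpleGraph.Adj.reachable (G := c1.induce Xᶜ) (u := ⟨u, hu⟩) (v := ⟨w, hw⟩) huw).trans
        (ih hw hv)
  rintro ⟨p, hp⟩ ⟨q, hq⟩
  obtain ⟨C, D, hC, -, hCD⟩ := h.1
  have hcomp {p : Plane} (hp : p ∉ X) : S.complGraph.connectedComponentMk ⟨p, hout hp⟩ = D :=
    (hCD _).resolve_left fun hpC => hp (h.2 ▸ Or.inr ⟨hout hp, by rwa [hpC]⟩)
  obtain ⟨w⟩ := SimpleGraph.ConnectedComponent.eq.1 ((hcomp hp).trans (hcomp hq).symm)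
  exact hwalk w hp hq

lemma IsBoundingCurve.exists_pt_eq_add_nsmul (h : S.IsBoundingCurve X) {p : Plane} (hp : p ∈ X)
    (hpS : p ∉ S.carrier) {e : Plane} (he : c1.Adj 0 e) :
    ∃ (i : ZMod S.len) (m : ℕ), S.pt i = p + (m + 1) • e := by
  obtain ⟨_, ⟨hX, hS, m, rfl⟩, hm⟩ := exists_add_notMem
    (Y := {q | q ∈ X ∧ q ∉ S.carrier ∧ ∃ m : ℕ, q = p + m • e})
    (h.finite.subset fun q hq => hq.1) ⟨p, hp, hpS, 0, by simp⟩ he.ne'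
  have hadj : c1.Adj (p + m • e) (p + m • e + e) := by
    rw [c1_adj_iff] at he ⊢
    simpa using he
  have hnext : p + m • e + e = p + (m + 1) • e := by rw [succ_nsmul, add_assoc]
  have hcarrier : p + m • e + e ∈ S.carrier := by
    by_contra hc
    exact hm ⟨h.mem_of_adj hX hS hadj, hc, m + 1, hnext⟩
  obtain ⟨i, hi⟩ := hcarrier
  exact ⟨i, m, hi.trans hnext⟩

/-- The curve passes to the left and to the right of an interior point, so that two of its points
are not `c₂`-adjacent. -/
lemma IsBoundingCurve.four_le (h : S.IsBoundingCurve X) : 4 ≤ S.len := by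
  by_contra! hlt
  obtain ⟨p, hp, hpS⟩ := h.exists_notMem_carrier
  obtain ⟨i, m, hi⟩ := h.exists_pt_eq_add_nsmul hp hpS (e := (1, 0)) (by simp [c1_adj_iff])
  obtain ⟨j, l, hj⟩ := h.exists_pt_eq_add_nsmul hp hpS (e := (-1, 0)) (by simp [c1_adj_iff])
  have hstep (k : ZMod S.len) : (S.pt k).1 ≤ (S.pt (k + 1)).1 + 1 ∧
      (S.pt (k + 1)).1 ≤ (S.pt k).1 + 1 := by
    rcases S.step k with heq | hadj
    · rw [← heq]
      omega
    · exact (c2_adj_iff.1 hadj).2.1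
  have hclose : (S.pt i).1 ≤ (S.pt j).1 + 1 := by
    rcases eq_or_eq_add_one_of_lt_four S.len_ne_zero.out hlt i j with rfl | rfl | rfl
    · omega
    · exact (hstep i).1
    · exact (hstep j).2
  rw [hi, hj] at hclose
  simp only [Prod.fst_add, Prod.smul_fst] at hclose
  simp only [nsmul_eq_mul] at hclose
  omega

lemma IsBoundingCurve.isCircuit (h : S.IsBoundingCurve X) : IsCircuit S.pt where
  four_le := h.four_le
  injective := S.injective
  adj i := by
    have : Fact (1 < S.len) := ⟨by have := h.four_le; omega⟩
    exact (S.step i).resolve_left fun heq => by simpa using S.injective heq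

lemma pt_mem_arc (i : ZMod S.len) {j k : ℕ} (h : j ≤ k) : S.pt (i + j) ∈ S.arc i k := ⟨j, h, rfl⟩

lemma isSegment_arc (h : IsCircuit S.pt) {i : ZMod S.len} {d : Plane} {K : ℕ} (hK : 0 < K)
    (hline : ∀ j ≤ K, S.pt (i + j) = S.pt i + j • d) : IsSegment (S.arc i K) := by
  have hi : S.pt i ∈ S.arc i K := ⟨0, K.zero_le, by simp⟩
  refine ⟨(Set.finite_range S.pt).subset ?_, ⟨S.pt i, hi, S.pt (i + 1), ⟨1, hK, by simp⟩,
    (h.adj i).ne⟩, Or.inr ?_, ?_⟩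
  · rintro _ ⟨j, -, rfl⟩
    exact ⟨_, rfl⟩
  · have hreach (j : ℕ) (hj : j ≤ K) : (c2.induce (S.arc i K)).Reachable ⟨S.pt i, hi⟩
        ⟨S.pt (i + j), pt_mem_arc i hj⟩ := by
      induction j with
      | zero => simp
      | succ j ih =>
        refine (ih (by omega)).trans (SimpleGraph.Adj.reachable ?_)
        simpa [add_assoc] using h.adj (i + j)
    refine SimpleGraph.connected_iff_exists_forall_reachable _ |>.2 ⟨⟨S.pt i, hi⟩, ?_⟩
    rintro ⟨_, j, hj, rfl⟩
    exact hreach j hj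
  · refine (collinear_iff_of_mem (Set.mem_image_of_mem toC hi)).2 ⟨toC d, ?_⟩
    rintro _ ⟨_, ⟨j, hj, rfl⟩, rfl⟩
    exact ⟨j, by rw [hline j hj, toC_add_nsmul]⟩

lemma notMem_of_turn (h : IsCircuit S.pt) {i : ZMod S.len} (hi : Turn S.pt i) {Y : Set Plane}
    (hY : IsSegment Y) (hprev : S.pt (i - 1) ∈ Y) (hmem : S.pt i ∈ Y) : S.pt (i + 1) ∉ Y :=
  fun hnext => h.cross_ne_zero_of_turn hi (cross_eq_zero_of_collinear hY.2.2.2 hprev hmem hnext)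

lemma mem_sideEndpoints_of_turn (h : IsCircuit S.pt) {i : ZMod S.len} (hi : Turn S.pt i) :
    S.pt i ∈ S.sideEndpoints := by
  obtain ⟨K, hK, hturn, hline⟩ := h.exists_turn i
  refine ⟨i, K, ⟨isSegment_arc h hK hline, fun i' k' hseg hsub => ?_⟩, Or.inl rfl⟩
  have hmem {j : ℕ} (hj : j ≤ K) : S.pt (i + j) ∈ S.arc i' k' := hsub (pt_mem_arc i hj)
  have hprev : S.pt (i - 1) ∉ S.arc i' k' := fun hp =>
    notMem_of_turn h hi hseg hp (by simpa using hmem K.zero_le) (by simpa using hmem hK)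
  have hnext : S.pt (i + K + 1) ∉ S.arc i' k' := by
    refine notMem_of_turn h hturn hseg ?_ (hmem le_rfl)
    simpa [Nat.cast_pred hK, add_sub_assoc] using hmem (K.sub_le 1)
  have hstart : i = i' := by
    obtain ⟨j, hj, heq⟩ := hmem K.zero_le
    rw [Nat.cast_zero, add_zero] at heq
    rcases j.eq_zero_or_pos with rfl | hpos
    · simpa using S.injective heq
    · refine absurd ⟨j - 1, by omega, ?_⟩ hprev
      rw [S.injective heq, Nat.cast_pred hpos, add_sub_assoc]
  subst hstart
  refine Set.Subset.antisymm ?_ hsub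
  rintro _ ⟨l, hl, rfl⟩
  refine pt_mem_arc i (not_lt.1 fun hlK => hnext ?_)
  simpa [add_assoc] using pt_mem_arc i (show K + 1 ≤ k' by omega)

lemma IsBoundingCurve.isConvexDisk (h : S.IsBoundingCurve X)
    (hext : toC '' S.sideEndpoints ⊆ (convexHull ℝ (toC '' X)).extremePoints ℝ) :
    IsConvexDisk S.pt X where
  toIsCircuit := h.isCircuit
  mem i := h.2 ▸ Or.inl ⟨i, rfl⟩
  finite := h.finite
  mem_of_adj _ hp hpS _ hq := h.mem_of_adj hp hpS hq
  preconnected_compl := h.preconnected_compl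
  extreme _ hi := isExtremeIn_of_mem_extremePoints
    (hext (Set.mem_image_of_mem toC (mem_sideEndpoints_of_turn h.isCircuit hi)))

end ClosedCurve

lemma exists_isConvexDisk {X : Set Plane} (hdisk : ∃ S : ClosedCurve, S.IsBoundingCurve X)
    (hconvex : IsDigitallyConvex X) : ∃ S : ClosedCurve, IsConvexDisk S.pt X := by
  obtain ⟨S, hS⟩ := hdisk
  obtain ⟨p, hp, hpS⟩ := hS.exists_notMem_carrier
  have hright : p + (1, 0) ∈ X := hS.mem_of_adj hp hpS (by simp [c1_adj_iff])
  have hup : p + (0, 1) ∈ X := hS.mem_of_adj hp hpS (by simp [c1_adj_iff])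
  rcases hconvex with ⟨q, rfl⟩ | hseg | ⟨T, hT, hext⟩
  · rw [Set.mem_singleton_iff.1 hp, Set.mem_singleton_iff, add_eq_left] at hright
    exact absurd hright (by decide)
  · have := cross_eq_zero_of_collinear hseg.2.2.2 hright hp hup
    simp [cross] at this
  · exact ⟨T, hT.isConvexDisk hext.subset⟩

end BoundingCurve

end DigitalImage

theorem theorem6p3_general (X : Set DigitalImage.Plane)
    (hdisk : ∃ S : DigitalImage.ClosedCurve, S.IsBoundingCurve X)
    (hconvex : DigitalImage.IsDigitallyConvex X) (A : Set X) :
    DigitalImage.IsCold (DigitalImage.c1.induce X) A ↔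
      DigitalImage.IsFreezing (DigitalImage.c1.induce X) A := by
  refine ⟨fun hA f hf hfix => ?_, fun hA => hA.isSCold 1⟩
  obtain ⟨S, D⟩ := DigitalImage.exists_isConvexDisk hdisk hconvex
  have hmove (x : X) : (DigitalImage.c1.induce X).edist x (f x) ≤ 1 := hA f hf hfix x
  exact D.eq_id hf hmove fun x hx => hfix x (hA.mem_of_isFoldable hx)

theorem theorem6p3 (X : Set DigitalImage.Plane) (hthick : DigitalImage.IsThickDisk X)
    (hconvex : DigitalImage.IsDigitallyConvex X) (A : Set X) :
    DigitalImage.IsCold (DigitalImage.c1.induce X) A ↔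
      DigitalImage.IsFreezing (DigitalImage.c1.induce X) A :=
  theorem6p3_general X (hthick.imp fun _ h => h.1) hconvex A
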